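/- Let $p$ be a prime and let $G$ be a finite $p$-solvable group (that is, $G$ has a normal series each of whose factors is a $p$-group or a group of order prime to $p$) with $O_p(G)=1$, where $O_p(G)$ denotes the largest normal $p$-subgroup of $G$. Let $R$ be a $p$-subgroup of $G$ that is weakly subnormal in $G$, i.e. $R$ is not subnormal in $G$ but $R$ is subnormal in every proper subgroup of $G$ containing $R$. Then there are a prime $q\neq p$ and a normal subgroup $Q$ of $G$ such that $G=QR$; $Q$ is a special $q$-group, i.e. a $q$-group that is either elementary abelian or satisfies $\Phi(Q)=[Q,Q]=Z(Q)$, where $\Phi(Q)$ denotes the Frattini subgroup of $Q$; $R$ centralizes $\Phi(Q)$; and $R$ acts irreducibly by conjugation on $Q/\Phi(Q)$ (i.e. $Q/\Phi(Q)\neq 1$, and its only $R$-invariant subgroups are $1$ and $Q/\Phi(Q)$). In particular, $G$ is solvable and $R$ is a Sylow $p$-subgroup of $G$. -/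

import Mathlib

open scoped Pointwise

/-- A (finite) group `G` is `p`-solvable if it has a normal series
`1 = H 0 ≤ H 1 ≤ ... ≤ H n = G` (each term normal in `G`) all of whose factors
`H (i + 1) / H i` are `p`-groups or `p'`-groups. -/
def IsPSolvable (p : ℕ) (G : Type*) [Group G] : Prop :=
  ∃ (n : ℕ) (H : ℕ → Subgroup G) (_ : ∀ i, (H i).Normal),
    H 0 = ⊥ ∧ H n = ⊤ ∧
    ∀ i < n, H i ≤ H (i + 1) ∧
      (IsPGroup p (H (i + 1) ⧸ (H i).subgroupOf (H (i + 1))) ∨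
        p.Coprime (Nat.card (H (i + 1) ⧸ (H i).subgroupOf (H (i + 1)))))

/-- `O_p(G)`: the subgroup generated by all normal `p`-subgroups of `G`, i.e. (for `p` prime)
the largest normal `p`-subgroup of `G`. -/
def pCore (p : ℕ) (G : Type*) [Group G] : Subgroup G :=
  sSup {N : Subgroup G | N.Normal ∧ IsPGroup p N}

/-- `R` is weakly subnormal in `G`: it is not subnormal in `G`, but it is subnormal in every
proper subgroup of `G` containing it. -/
def IsWeaklySubnormal {G : Type*} [Group G] (R : Subgroup G) : Prop :=
  ¬ R.IsSubnormal ∧ ∀ H : Subgroup G, R ≤ H → H ≠ ⊤ → (R.subgroupOf H).IsSubnormal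

/-- `P` is an elementary abelian `q`-group. -/
def IsElementaryAbelian (q : ℕ) (P : Type*) [Group P] : Prop :=
  (∀ a b : P, a * b = b * a) ∧ ∀ a : P, a ^ q = 1

/-- `P` is a special `q`-group: a `q`-group that is elementary abelian or satisfies
`Φ(P) = [P, P] = Z(P)`. -/
def IsSpecialGroup (q : ℕ) (P : Type*) [Group P] : Prop :=
  IsPGroup q P ∧
    (IsElementaryAbelian q P ∨
      (frattini P = commutator P ∧ commutator P = Subgroup.center P))

/-- The automorphism of `Q / Φ(Q)` induced by conjugation by `g ∈ G` on the normal
subgroup `Q`. -/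
noncomputable def frattiniQuotientConj {G : Type*} [Group G] (Q : Subgroup G) [Q.Normal]
    (g : G) : (Q ⧸ frattini Q) ≃* (Q ⧸ frattini Q) :=
  QuotientGroup.congr (frattini Q) (frattini Q) (MulAut.conjNormal g)
    (Subgroup.characteristic_iff_map_eq.mp inferInstance _)

/-- `R` acts irreducibly, by conjugation, on `Q / Φ(Q)`: this group is nontrivial and its only
`R`-invariant subgroups are the trivial one and the whole group. -/
def ActsIrreduciblyOnFrattiniQuotient {G : Type*} [Group G] (R Q : Subgroup G) [Q.Normal] :
    Prop :=
  Nontrivial (Q ⧸ frattini Q) ∧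
    ∀ U : Subgroup (Q ⧸ frattini Q),
      (∀ r ∈ R, ∀ u ∈ U, frattiniQuotientConj Q r u ∈ U) → U = ⊥ ∨ U = ⊤

/-! Let `N` be the largest normal `p'`-subgroup. Since `O_p(G) = 1`, `p`-solvability gives `C_G(N) ≤
N`, so `R`, being nontrivial, acts nontrivially on `N`. By coprimality `R` stabilizes a Sylow
`q`-subgroup of `N` for each `q`; these cannot all be centralized, so some `Q` among them is not. If
`R` normalizes a `p'`-subgroup `U` and is subnormal in `UR`, it is a normal Sylow subgroup there and
centralizes `U`. Weak subnormality therefore forces `G = QR`, and `R` centralizes every proper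
`R`-invariant subgroup of `Q` (`IsMinimallyNontrivial`). The rest is coprime action: `Q = [Q, R]`,
so fixed points lie in `[Q, Q]`. Hence every proper invariant subgroup lies in `[Q, Q] = Φ(Q)`,
which gives irreducibility and, applied to `Z(Q)` or to the `q`-th powers, speciality. -/

lemma eq_one_of_pow_eq_one_of_coprime_card {Q : Type*} [Group Q] {n : ℕ}
    (hn : n.Coprime (Nat.card Q)) {c : Q} (h : c ^ n = 1) : c = 1 :=
  orderOf_eq_one_iff.1 <| Nat.eq_one_of_dvd_coprimes hn (orderOf_dvd_of_pow_eq_one h)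
    (orderOf_dvd_natCard c)

lemma Subgroup.Characteristic.apply_mem {Q : Type*} [Group Q] {U : Subgroup Q}
    (hU : U.Characteristic) (e : MulAut Q) {u : Q} (hu : u ∈ U) : e u ∈ U := by
  rw [← hU.fixed e] at hu
  exact hu

lemma commutator_le_frattini_of_isNilpotent (Q : Type*) [Group Q] [Group.IsNilpotent Q] :
    commutator Q ≤ frattini Q := by
  refine le_iInf₂ fun M (hM : IsCoatom M) ↦ ?_
  have hn : M.Normal :=
    Subgroup.NormalizerCondition.normal_of_coatom _ Group.normalizerCondition_of_isNilpotent hM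
  by_contra hle
  have htop : M ⊔ commutator Q = ⊤ := hM.2 _ (left_lt_sup.2 hle)
  have : Nontrivial (Q ⧸ M) := QuotientGroup.nontrivial_iff.2 hM.1
  -- If `M` missed part of `[Q, Q]`, the solvable group `Q ⧸ M` would be perfect.
  refine (Group.IsSolvable.commutator_lt_top_of_nontrivial (Q ⧸ M)).ne ?_
  have hsurj := QuotientGroup.mk'_surjective M
  have h1 : (M ⊔ commutator Q).map (QuotientGroup.mk' M) = ⊤ := by
    rw [htop, Subgroup.map_top_of_surjective _ hsurj]
  rw [Subgroup.map_sup, (Subgroup.map_eq_bot_iff _).2 (QuotientGroup.ker_mk' M).ge, bot_sup_eq,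
    commutator_def, Subgroup.map_commutator, Subgroup.map_top_of_surjective _ hsurj] at h1
  exact h1

lemma frattini_ne_top (Q : Type*) [Group Q] [Finite Q] [Nontrivial Q] : frattini Q ≠ ⊤ := by
  intro h
  have := frattini_nongenerating (K := (⊥ : Subgroup Q)) (by simp [h])
  exact bot_ne_top this

/-! ### Coprime action on a group -/

section CoprimeAction

variable {A Q : Type*} [Group A] [Group Q]

/-- The subgroup `[Q, A]` generated by the elements `x⁻¹ * φ a x`. -/
def actionCommutator (φ : A →* MulAut Q) : Subgroup Q :=
  Subgroup.closure {y | ∃ (x : Q) (a : A), y = x⁻¹ * φ a x}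

lemma map_mem_actionCommutator (φ : A →* MulAut Q) (a : A) {u : Q}
    (hu : u ∈ actionCommutator φ) : φ a u ∈ actionCommutator φ := by
  have : actionCommutator φ ≤ (actionCommutator φ).comap (φ a).toMonoidHom := by
    refine (Subgroup.closure_le _).2 ?_
    rintro _ ⟨x, b, rfl⟩
    refine Subgroup.subset_closure ⟨φ a x, a * b * a⁻¹, ?_⟩
    simp [MulAut.mul_apply]
  exact this hu

/-- If a coprime action is trivial on `[Q, A]`, then it is trivial. -/
lemma eq_self_of_forall_actionCommutator_fixed (φ : A →* MulAut Q)
    (hc : (Nat.card A).Coprime (Nat.card Q))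
    (h : ∀ a, ∀ u ∈ actionCommutator φ, φ a u = u) (a : A) (x : Q) : φ a x = x := by
  set c := x⁻¹ * φ a x with hcdef
  have hca : φ a c = c := h a c (Subgroup.subset_closure ⟨x, a, rfl⟩)
  have hx : φ a x = x * c := by simp [hcdef]
  -- As `a` fixes `c`, powers of `a` multiply `x` by powers of `c`; taking `n = |A|` gives `c ^ |A|
  -- = 1`.
  have hpow : ∀ n : ℕ, φ (a ^ n) x = x * c ^ n := by
    intro n
    induction n with
    | zero => simp
    | succ n ih =>
      rw [pow_succ', map_mul, MulAut.mul_apply, ih, map_mul, hx, map_pow, hca, pow_succ', mul_assoc]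
  have h1 := hpow (Nat.card A)
  rw [pow_card_eq_one', map_one, MulAut.one_apply, left_eq_mul] at h1
  rw [hx, eq_one_of_pow_eq_one_of_coprime_card hc h1, mul_one]

/-- If `Q = [Q, A]` and the action is coprime, then all fixed points lie in `[Q, Q]`. -/
lemma mem_commutator_of_forall_fixed [Finite A] (φ : A →* MulAut Q)
    (hc : (Nat.card A).Coprime (Nat.card Q)) (htop : actionCommutator φ = ⊤) {u : Q}
    (hu : ∀ a, φ a u = u) : u ∈ commutator Q := by
  have := Fintype.ofFinite A
  -- The norm map is `A`-invariant, so it kills `[Q, A] = Q`; it sends a fixed point `u` to the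
  -- class of `u ^ |A|`.
  let T : Q →* Abelianization Q := ∏ a : A, (Abelianization.of.comp (φ a).toMonoidHom)
  have hT : ∀ x, T x = ∏ a : A, Abelianization.of (φ a x) := fun x ↦ by
    simp [T, MonoidHom.finsetProd_apply]
  have hTb : ∀ b x, T (φ b x) = T x := fun b x ↦ by
    rw [hT, hT]
    refine Fintype.prod_equiv (Equiv.mulRight b) _ _ fun a ↦ ?_
    simp [MulAut.mul_apply]
  have hker : T.ker = ⊤ := by
    rw [← top_le_iff, ← htop]
    refine (Subgroup.closure_le _).2 ?_
    rintro _ ⟨x, a, rfl⟩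
    simp [MonoidHom.mem_ker, hTb]
  have h1 : T u = 1 := by
    rw [← MonoidHom.mem_ker, hker]; trivial
  rw [hT] at h1
  simp only [hu, Finset.prod_const, Finset.card_univ, ← Nat.card_eq_fintype_card] at h1
  have h2 : (Nat.card A).Coprime (Nat.card (Abelianization Q)) :=
    hc.coprime_dvd_right (Subgroup.card_quotient_dvd_card _)
  have h3 := eq_one_of_pow_eq_one_of_coprime_card h2 h1
  rwa [← MonoidHom.mem_ker, Abelianization.ker_of] at h3

/-- A group of automorphisms acts trivially on every proper invariant subgroup, but not on the
whole group. -/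
structure IsMinimallyNontrivial (φ : A →* MulAut Q) : Prop where
  nontrivial : ∃ a x, φ a x ≠ x
  fixed : ∀ U : Subgroup Q, (∀ a, ∀ u ∈ U, φ a u ∈ U) → U ≠ ⊤ → ∀ a, ∀ u ∈ U, φ a u = u

namespace IsMinimallyNontrivial

variable {φ : A →* MulAut Q}

lemma actionCommutator_eq_top (h : IsMinimallyNontrivial φ)
    (hc : (Nat.card A).Coprime (Nat.card Q)) : actionCommutator φ = ⊤ := by
  by_contra hne
  obtain ⟨a, x, hax⟩ := h.nontrivial
  exact hax <| eq_self_of_forall_actionCommutator_fixed φ hc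
    (h.fixed _ (fun a _ hu ↦ map_mem_actionCommutator φ a hu) hne) a x

lemma le_commutator [Finite A] (h : IsMinimallyNontrivial φ) (hc : (Nat.card A).Coprime (Nat.card Q))
    {U : Subgroup Q} (hU : ∀ a, ∀ u ∈ U, φ a u ∈ U) (hne : U ≠ ⊤) : U ≤ commutator Q :=
  fun u hu ↦ mem_commutator_of_forall_fixed φ hc (h.actionCommutator_eq_top hc)
    fun a ↦ h.fixed U hU hne a u hu

end IsMinimallyNontrivial

namespace IsMinimallyNontrivial

variable [Finite A] [Finite Q] {φ : A →* MulAut Q} {q : ℕ}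

lemma commutator_eq_frattini (h : IsMinimallyNontrivial φ)
    (hc : (Nat.card A).Coprime (Nat.card Q)) [Group.IsNilpotent Q] :
    frattini Q = commutator Q ∧ frattini Q ≠ ⊤ := by
  have : Nontrivial Q := by
    obtain ⟨a, x, hax⟩ := h.nontrivial
    exact ⟨_, _, hax⟩
  exact ⟨le_antisymm (h.le_commutator hc
    (fun a _ hu ↦ frattini_characteristic.apply_mem (φ a) hu) (frattini_ne_top Q))
    (commutator_le_frattini_of_isNilpotent Q), frattini_ne_top Q⟩

lemma fixed_of_mem_frattini (h : IsMinimallyNontrivial φ)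
    (hc : (Nat.card A).Coprime (Nat.card Q)) [Group.IsNilpotent Q] (a : A) {u : Q}
    (hu : u ∈ frattini Q) : φ a u = u :=
  h.fixed _ (fun a _ hu ↦ frattini_characteristic.apply_mem (φ a) hu)
    (h.commutator_eq_frattini hc).2 a u hu

/-- For `z ∈ Φ(Q)`, both `z` and its conjugates are fixed by `A`, so each `x⁻¹ * φ a x` centralizes
`z`; these elements generate `Q`. -/
lemma frattini_le_center (h : IsMinimallyNontrivial φ)
    (hc : (Nat.card A).Coprime (Nat.card Q)) [Group.IsNilpotent Q] :
    frattini Q ≤ Subgroup.center Q := by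
  intro z hz
  have hle : actionCommutator φ ≤ Subgroup.centralizer {z} := by
    refine (Subgroup.closure_le _).2 ?_
    rintro _ ⟨x, a, rfl⟩
    have h1 := h.fixed_of_mem_frattini hc a
      ((inferInstance : (frattini Q).Normal).conj_mem z hz x)
    rw [map_mul, map_mul, map_inv, h.fixed_of_mem_frattini hc a hz] at h1
    rw [SetLike.mem_coe, Subgroup.mem_centralizer_singleton_iff]
    calc x⁻¹ * φ a x * z = x⁻¹ * (φ a x * z * (φ a x)⁻¹) * φ a x := by group
      _ = z * (x⁻¹ * φ a x) := by rw [h1]; group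
  rw [h.actionCommutator_eq_top hc] at hle
  rw [Subgroup.mem_center_iff]
  exact fun x ↦ Subgroup.mem_centralizer_singleton_iff.1 (hle (Subgroup.mem_top x))

lemma isSpecialGroup (h : IsMinimallyNontrivial φ)
    (hc : (Nat.card A).Coprime (Nat.card Q)) [Fact q.Prime] (hQ : IsPGroup q Q) :
    IsSpecialGroup q Q := by
  have := hQ.isNilpotent
  have hfr := h.commutator_eq_frattini hc
  refine ⟨hQ, or_iff_not_imp_right.2 fun hns ↦ ?_⟩
  have hcomm : ∀ a b : Q, a * b = b * a := by
    by_contra hnc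
    refine hns ⟨hfr.1, le_antisymm (hfr.1 ▸ h.frattini_le_center hc) (h.le_commutator hc
      (fun a _ hu ↦ Subgroup.centerCharacteristic.apply_mem (φ a) hu) fun htop ↦ hnc ?_)⟩
    intro a b
    exact (Subgroup.mem_center_iff.1 (htop ▸ Subgroup.mem_top b) a)
  have hbot : commutator Q = ⊥ := by
    rw [commutator_def, Subgroup.commutator_eq_bot_iff_le_centralizer]
    exact fun x _ y _ ↦ hcomm _ _
  let _ : CommGroup Q := { ‹Group Q› with mul_comm := hcomm }
  -- The `q`-th powers form a proper invariant subgroup, hence lie in `[Q, Q] = 1`.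
  have hrange : (powMonoidHom q : Q →* Q).range ≠ ⊤ := by
    intro htop
    have hinj : Function.Injective (powMonoidHom q : Q →* Q) :=
      Finite.injective_iff_surjective.2 (MonoidHom.range_eq_top.1 htop)
    obtain ⟨a, x, hax⟩ := h.nontrivial
    have : Nontrivial Q := ⟨_, _, hax⟩
    obtain ⟨n, hn⟩ := IsPGroup.iff_card.1 hQ
    have hqd : q ∣ Nat.card Q := by
      rw [hn]
      refine dvd_pow_self _ ?_
      rintro rfl
      exact (Finite.one_lt_card (α := Q)).ne' (by simpa using hn)
    obtain ⟨y, hy⟩ := exists_prime_orderOf_dvd_card' q hqd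
    have h1 : y = 1 := hinj (by simp [← hy, pow_orderOf_eq_one])
    have h2 := (Fact.out : q.Prime).one_lt
    rw [← hy, h1, orderOf_one] at h2
    exact lt_irrefl _ h2
  refine ⟨hcomm, fun x ↦ ?_⟩
  have hle := h.le_commutator hc (U := (powMonoidHom q : Q →* Q).range)
    (by rintro a _ ⟨y, rfl⟩; exact ⟨φ a y, by simp⟩) hrange
  rw [hbot] at hle
  exact Subgroup.mem_bot.1 (hle ⟨x, rfl⟩)

/-- Every proper invariant subgroup is contained in the Frattini subgroup. -/
lemma le_frattini (h : IsMinimallyNontrivial φ) (hc : (Nat.card A).Coprime (Nat.card Q))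
    [Group.IsNilpotent Q] {U : Subgroup Q} (hU : ∀ a, ∀ u ∈ U, φ a u ∈ U) (hne : U ≠ ⊤) :
    U ≤ frattini Q :=
  (h.commutator_eq_frattini hc).1 ▸ h.le_commutator hc hU hne

end IsMinimallyNontrivial

end CoprimeAction

/-! ### Sylow subgroups, subnormality and `p'`-subgroups -/

lemma Sylow.mem_of_mem_normalizer {p : ℕ} {G : Type*} [Group G] (P : Sylow p G) {x : G}
    (hx : IsPGroup p (Subgroup.zpowers x)) (hn : x ∈ Subgroup.normalizer (P : Set G)) : x ∈ P := by
  have h : x ∈ Subgroup.zpowers x ⊓ Subgroup.normalizer (P : Set G) :=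
    ⟨Subgroup.mem_zpowers x, hn⟩
  have h2 := hx.inf_normalizer_sylow P
  exact (h2 ▸ h : x ∈ Subgroup.zpowers x ⊓ (P : Subgroup G)).2

/-- A subnormal Sylow subgroup is normal. -/
lemma Sylow.normal_of_isSubnormal {p : ℕ} {G : Type*} [Group G] (P : Sylow p G)
    (hP : (P : Subgroup G).IsSubnormal) : (P : Subgroup G).Normal := by
  -- Normality of `P` climbs the subnormal chain: for `H` normal in `K`, a `K`-conjugate of `P` lies
  -- in `H`, so it normalizes `P` and, being a `p`-group, lies in `P`.
  have key : ∀ K : Subgroup G, K.IsSubnormal → (P : Subgroup G) ≤ K →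
      ((P : Subgroup G).subgroupOf K).Normal → (P : Subgroup G).Normal := by
    intro K hK
    induction hK with
    | top =>
      intro hle hn
      rw [Subgroup.normal_subgroupOf_iff hle] at hn
      exact ⟨fun x hx g ↦ hn x g hx trivial⟩
    | step H K hHK _ hN ih =>
      intro hle hn
      refine ih (hle.trans hHK) ?_
      rw [Subgroup.normal_subgroupOf_iff_le_normalizer hle] at hn
      rw [Subgroup.normal_subgroupOf_iff hHK] at hN
      rw [Subgroup.normal_subgroupOf_iff (hle.trans hHK)]
      intro x k hx hk
      refine P.mem_of_mem_normalizer ?_ (hn (hN x k (hle hx) hk))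
      have h1 : IsPGroup p ((P : Subgroup G).map (MulAut.conj k).toMonoidHom) := P.2.map _
      refine h1.to_le ?_
      rw [Subgroup.zpowers_le]
      exact ⟨x, hx, rfl⟩
  exact key _ hP le_rfl (by rw [Subgroup.subgroupOf_self]; infer_instance)

lemma Subgroup.normal_subgroupOf_sup_of_forall_conj_mem {G : Type*} [Group G] {U R : Subgroup G}
    (h : ∀ r ∈ R, ∀ u ∈ U, r * u * r⁻¹ ∈ U) : (U.subgroupOf (U ⊔ R)).Normal := by
  rw [Subgroup.normal_subgroupOf_iff_le_normalizer le_sup_left]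
  refine sup_le Subgroup.le_normalizer fun r hr ↦ ?_
  rw [Subgroup.mem_normalizer_iff]
  refine fun u ↦ ⟨h r hr u, fun hu ↦ ?_⟩
  simpa [mul_assoc] using h r⁻¹ (inv_mem hr) _ hu

lemma le_pCore {p : ℕ} {G : Type*} [Group G] {N : Subgroup G} (hN : N.Normal) (hp : IsPGroup p N) : N ≤ pCore p G :=
  le_sSup ⟨hN, hp⟩

lemma coprime_card_sup {p : ℕ} {G : Type*} [Group G] {N M : Subgroup G} [N.Normal] (hN : p.Coprime (Nat.card N))
    (hM : p.Coprime (Nat.card M)) : p.Coprime (Nat.card (N ⊔ M : Subgroup G)) := by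
  rw [← Subgroup.relIndex_bot_left, ← Subgroup.relIndex_mul_relIndex ⊥ N _ bot_le le_sup_left,
    Subgroup.relIndex_bot_left, Subgroup.relIndex_sup_left]
  exact hN.mul_right (hM.coprime_dvd_right (Subgroup.relIndex_dvd_card N M))

section

variable {p : ℕ} [Fact p.Prime] {G : Type*} [Group G] [Finite G]

lemma IsPGroup.coprime_card_of_coprime {U R : Subgroup G} (hR : IsPGroup p R)
    (hU : p.Coprime (Nat.card U)) : (Nat.card R).Coprime (Nat.card U) := by
  obtain ⟨n, hn⟩ := IsPGroup.iff_card.1 hR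
  rw [hn]
  exact hU.pow_left n

lemma not_dvd_index_of_sup_eq_top {U R : Subgroup G} [U.Normal]
    (hU : p.Coprime (Nat.card U)) (hsup : U ⊔ R = ⊤) : ¬ p ∣ R.index := by
  intro h
  have h1 : R.index ∣ Nat.card U := by
    obtain ⟨m, hm⟩ := Subgroup.relIndex_dvd_card U R
    have h2 : U.index = U.relIndex R := by
      rw [← Subgroup.relIndex_sup_left, hsup, Subgroup.relIndex_top_right]
    have h3 := U.card_mul_index.trans R.card_mul_index.symm
    rw [hm, ← h2, mul_comm, mul_assoc] at h3
    exact ⟨m, by rw [Nat.eq_of_mul_eq_mul_left (Nat.pos_of_ne_zero U.index_ne_zero_of_finite) h3,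
      mul_comm]⟩
  exact (Nat.Prime.coprime_iff_not_dvd Fact.out).1 hU (h.trans h1)

lemma IsPGroup.commute_of_isSubnormal_of_sup_eq_top {U R : Subgroup G} [hn : U.Normal]
    (hU : p.Coprime (Nat.card U)) (hR : IsPGroup p R) (hsup : U ⊔ R = ⊤) (hsub : R.IsSubnormal) :
    ∀ r ∈ R, ∀ u ∈ U, r * u = u * r := by
  have hRn := (hR.toSylow (not_dvd_index_of_sup_eq_top hU hsup)).normal_of_isSubnormal hsub
  intro r hr u hu
  exact Subgroup.commute_of_normal_of_disjoint R U hRn hn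
    (Subgroup.disjoint_of_coprime_natCard (hR.coprime_card_of_coprime hU)) r u hr hu

/-- A `p`-subgroup `R` that acts on a `p'`-subgroup `U` and is subnormal in `UR` acts trivially
on `U`. -/
lemma IsPGroup.commute_of_isSubnormal {U R : Subgroup G}
    (hU : p.Coprime (Nat.card U)) (hR : IsPGroup p R)
    (hnorm : ∀ r ∈ R, ∀ u ∈ U, r * u * r⁻¹ ∈ U)
    (hsub : (R.subgroupOf (U ⊔ R)).IsSubnormal) :
    ∀ r ∈ R, ∀ u ∈ U, r * u = u * r := by
  have := Subgroup.normal_subgroupOf_sup_of_forall_conj_mem hnorm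
  have h1 := IsPGroup.commute_of_isSubnormal_of_sup_eq_top (p := p) (U := U.subgroupOf (U ⊔ R))
    (R := R.subgroupOf (U ⊔ R))
    (by rwa [Nat.card_congr (Subgroup.subgroupOfEquivOfLe le_sup_left).toEquiv])
    (hR.of_equiv (Subgroup.subgroupOfEquivOfLe le_sup_right).symm)
    (by rw [← Subgroup.subgroupOf_sup le_sup_left le_sup_right, Subgroup.subgroupOf_self]) hsub
  intro r hr u hu
  have h2 := h1 ⟨r, le_sup_right (a := U) hr⟩ (Subgroup.mem_subgroupOf.2 hr)
    ⟨u, le_sup_left (b := R) hu⟩ (Subgroup.mem_subgroupOf.2 hu)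
  exact congrArg Subtype.val h2

/-- There is a largest normal `p'`-subgroup. -/
lemma exists_largest_normal_coprime (p : ℕ) (G : Type*) [Group G] [Finite G] [Fact p.Prime] :
    ∃ N : Subgroup G, N.Normal ∧ p.Coprime (Nat.card N) ∧
      ∀ M : Subgroup G, M.Normal → p.Coprime (Nat.card M) → M ≤ N := by
  obtain ⟨N, ⟨hN, hc⟩, hmax⟩ :=
    (Set.toFinite {N : Subgroup G | N.Normal ∧ p.Coprime (Nat.card N)}).exists_maximal
      ⟨⊥, inferInstance, by simp⟩
  refine ⟨N, hN, hc, fun M hM hMc ↦ ?_⟩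
  exact le_sup_right.trans (hmax ⟨inferInstance, coprime_card_sup hc hMc⟩ le_sup_left)

/-- The Sylow `p`-subgroup of `K` is characteristic in `K`, hence normal in `G`, hence inside
`O_p(G)`. -/
lemma coprime_card_of_normal_of_isNilpotent (hcore : pCore p G = ⊥) {K : Subgroup G} [K.Normal]
    [Group.IsNilpotent K] : p.Coprime (Nat.card K) := by
  let P : Sylow p K := default
  have hPn : (P : Subgroup K).Normal :=
    P.normal_of_normalizerCondition Group.normalizerCondition_of_isNilpotent
  have hPc : (P : Subgroup K).Characteristic := P.characteristic_of_normal hPn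
  have hle : (P : Subgroup K).map K.subtype ≤ ⊥ :=
    hcore ▸ le_pCore inferInstance (P.2.map _)
  have hbot : (P : Subgroup K) = ⊥ :=
    (Subgroup.map_eq_bot_iff_of_injective _ K.subtype_injective).1 (le_bot_iff.1 hle)
  have := P.not_dvd_index
  rw [hbot, Subgroup.index_bot] at this
  exact (Nat.Prime.coprime_iff_not_dvd Fact.out).2 this

/-- In a `p`-solvable group with `O_p(G) = 1`, the largest normal `p'`-subgroup contains its own
centralizer. -/
lemma IsPSolvable.centralizer_le (hG : IsPSolvable p G) (hcore : pCore p G = ⊥) {N : Subgroup G}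
    [N.Normal] (hc : p.Coprime (Nat.card N))
    (hN : ∀ M : Subgroup G, M.Normal → p.Coprime (Nat.card M) → M ≤ N) :
    Subgroup.centralizer (N : Set G) ≤ N := by
  obtain ⟨n, H, hH, h0, hn, hstep⟩ := hG
  suffices h : ∀ i ≤ n, Subgroup.centralizer (N : Set G) ⊓ H i ≤ N by
    simpa [hn] using h n le_rfl
  intro i
  induction i with
  | zero => simp [h0]
  | succ i ih =>
    intro hi
    have hA := ih (by omega)
    obtain ⟨hle, hfac⟩ := hstep i (by omega)
    set K := Subgroup.centralizer (N : Set G) ⊓ H (i + 1) with hK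
    have hKn : K.Normal := inferInstance
    refine hN K hKn ?_
    let f : K →* H (i + 1) ⧸ (H i).subgroupOf (H (i + 1)) :=
      (QuotientGroup.mk' _).comp (Subgroup.inclusion inf_le_right)
    have hker : ∀ x ∈ f.ker, (x : G) ∈ N := by
      intro x hx
      refine hA ⟨x.2.1, ?_⟩
      have h1 : QuotientGroup.mk' ((H i).subgroupOf (H (i + 1)))
        (Subgroup.inclusion inf_le_right x) = 1 := hx
      rwa [← MonoidHom.mem_ker, QuotientGroup.ker_mk', Subgroup.mem_subgroupOf] at h1
    -- The kernel lies in `N`, which `K` centralizes. So a `p`-group factor makes `K` nilpotent,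
    -- hence a `p'`-group.
    have hcenter : f.ker ≤ Subgroup.center K := by
      intro x hx
      rw [Subgroup.mem_center_iff]
      intro y
      exact Subtype.ext (Subgroup.mem_centralizer_iff.1 y.2.1 x (hker x hx)).symm
    rcases hfac with hfac | hfac
    · have := hfac.isNilpotent
      have := Subgroup.isNilpotent_of_ker_le_center f hcenter
      exact coprime_card_of_normal_of_isNilpotent hcore
    · rw [← Subgroup.card_mul_index f.ker, Subgroup.index_ker]
      refine Nat.Coprime.mul_right ?_ (hfac.coprime_dvd_right (Subgroup.card_subgroup_dvd_card _))
      refine hc.coprime_dvd_right ?_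
      rw [← Subgroup.card_map_of_injective K.subtype_injective]
      refine Subgroup.card_dvd_of_le ?_
      rintro _ ⟨x, hx, rfl⟩
      exact hker x hx

/-- A `p`-group acting on a `p'`-group `N` by automorphisms stabilizes a Sylow `q`-subgroup. -/
lemma IsPGroup.exists_sylow_forall_map_mem {A N : Type*} [Group A] [Group N] [Finite N]
    (hA : IsPGroup p A) (φ : A →* MulAut N) (hN : p.Coprime (Nat.card N)) (q : ℕ) [Fact q.Prime] :
    ∃ S : Sylow q N, ∀ a, ∀ x ∈ S, φ a x ∈ S := by
  let _ : MulAction A (Sylow q N) := MulAction.compHom _ φ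
  -- The number of Sylow `q`-subgroups divides `|N|`, so the `p`-group `A` fixes one of them.
  have hnd : ¬ p ∣ Nat.card (Sylow q N) := by
    intro h
    let S : Sylow q N := default
    exact (Nat.Prime.coprime_iff_not_dvd Fact.out).1 hN
      (h.trans (S.card_dvd_index.trans (Subgroup.index_dvd_card _)))
  obtain ⟨S, hS⟩ := hA.nonempty_fixed_point_of_prime_not_dvd_card _ hnd
  refine ⟨S, fun a x hx ↦ ?_⟩
  have h1 : φ a • S = S := hS a
  have h2 : φ a x ∈ φ a • (S : Subgroup N) := Subgroup.smul_mem_pointwise_smul x (φ a) _ hx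
  have h3 := congrArg (Sylow.toSubgroup) h1
  rw [Sylow.pointwise_smul_def] at h3
  rwa [h3] at h2

/-- A `p`-group acting nontrivially on a `p'`-group stabilizes some Sylow subgroup on which it acts
nontrivially. -/
lemma IsPGroup.exists_sylow_forall_map_mem_and_exists_ne {A N : Type*} [Group A] [Group N]
    [Finite N] (hA : IsPGroup p A) (φ : A →* MulAut N) (hN : p.Coprime (Nat.card N))
    (hφ : ∃ a x, φ a x ≠ x) :
    ∃ q : ℕ, q.Prime ∧ ∃ S : Sylow q N, (∀ a, ∀ x ∈ S, φ a x ∈ S) ∧ ∃ a, ∃ x ∈ S, φ a x ≠ x := by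
  by_contra! hcon
  let F : Subgroup N :=
    { carrier := {x | ∀ a, φ a x = x}
      mul_mem' := fun hx hy a ↦ by rw [map_mul, hx a, hy a]
      one_mem' := fun a ↦ map_one _
      inv_mem' := fun hx a ↦ by rw [map_inv, hx a] }
  -- The fixed-point subgroup contains a Sylow `q`-subgroup for every `q`, so no prime divides its
  -- index.
  have hF : F.index = 1 := by
    refine Nat.eq_one_iff_not_exists_prime_dvd.2 fun q hq hdvd ↦ ?_
    have := Fact.mk hq
    obtain ⟨S, hS⟩ := hA.exists_sylow_forall_map_mem φ hN q
    have hle : (S : Subgroup N) ≤ F := fun x hx a ↦ hcon q hq S hS a x hx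
    exact S.not_dvd_index (hdvd.trans (Subgroup.index_dvd_of_le hle))
  obtain ⟨a, x, hax⟩ := hφ
  have hx : x ∈ F := Subgroup.index_eq_one.1 hF ▸ Subgroup.mem_top x
  exact hax (hx a)

end

/-! ### Weakly subnormal `p`-subgroups -/

lemma Subgroup.normal_of_sup_eq_top {G : Type*} [Group G] {U R : Subgroup G}
    (h : ∀ r ∈ R, ∀ u ∈ U, r * u * r⁻¹ ∈ U) (hsup : U ⊔ R = ⊤) : U.Normal := by
  have h1 := Subgroup.normal_subgroupOf_sup_of_forall_conj_mem h
  rw [Subgroup.normal_subgroupOf_iff_le_normalizer le_sup_left, hsup, top_le_iff] at h1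
  exact Subgroup.normalizer_eq_top_iff.1 h1

lemma isSolvable_of_sup_eq_top {G : Type*} [Group G] {Q R : Subgroup G} [Q.Normal] [Group.IsSolvable Q]
    [Group.IsSolvable R] (hsup : Q ⊔ R = ⊤) : Group.IsSolvable G := by
  refine (Group.isSolvable_iff_subgroup_quotient Q).2 ⟨inferInstance, ?_⟩
  refine Group.isSolvable_of_surjective (f := (QuotientGroup.mk' Q).comp R.subtype) fun y ↦ ?_
  obtain ⟨g, rfl⟩ := QuotientGroup.mk'_surjective Q y
  obtain ⟨r, hr, x, hx, rfl⟩ := Subgroup.mem_sup_of_normal_right.1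
    (show g ∈ R ⊔ Q by rw [sup_comm, hsup]; trivial)
  exact ⟨⟨r, hr⟩, by simpa [QuotientGroup.eq] using hx⟩

section

variable {p : ℕ} [Fact p.Prime] {G : Type*} [Group G] [Finite G] {R : Subgroup G}

lemma IsWeaklySubnormal.commute_of_sup_ne_top (hR : IsPGroup p R) (hws : IsWeaklySubnormal R)
    {U : Subgroup G} (hU : p.Coprime (Nat.card U)) (hnorm : ∀ r ∈ R, ∀ u ∈ U, r * u * r⁻¹ ∈ U)
    (hne : U ⊔ R ≠ ⊤) : ∀ r ∈ R, ∀ u ∈ U, r * u = u * r :=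
  hR.commute_of_isSubnormal hU hnorm (hws.2 _ le_sup_right hne)

/-- A weakly subnormal `p`-subgroup of a `p`-solvable group with `O_p(G) = 1` has a normal
`q`-subgroup, `q ≠ p`, as a supplement that it does not centralize. -/
lemma IsWeaklySubnormal.exists_normal_supplement (hG : IsPSolvable p G) (hcore : pCore p G = ⊥)
    (hR : IsPGroup p R) (hws : IsWeaklySubnormal R) :
    ∃ (q : ℕ) (Q : Subgroup G), Q.Normal ∧ q.Prime ∧ q ≠ p ∧ IsPGroup q Q ∧
      p.Coprime (Nat.card Q) ∧ Q ⊔ R = ⊤ ∧ ∃ r ∈ R, ∃ x ∈ Q, r * x * r⁻¹ ≠ x := by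
  obtain ⟨N, hN, hNc, hNmax⟩ := exists_largest_normal_coprime p G
  let φ : R →* MulAut N := MulAut.conjNormal.comp R.subtype
  have hφ : ∃ a x, φ a x ≠ x := by
    by_contra! hcon
    refine hws.1 ?_
    have hle : R ≤ N := by
      refine le_trans (fun r hr ↦ ?_) (hG.centralizer_le hcore hNc hNmax)
      refine Subgroup.mem_centralizer_iff.2 fun x hx ↦ ?_
      have h1 := congrArg Subtype.val (hcon ⟨r, hr⟩ ⟨x, hx⟩)
      exact (mul_inv_eq_iff_eq_mul.1 h1).symm
    have hbot : R = ⊥ := disjoint_self.1 <|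
      (Subgroup.disjoint_of_coprime_natCard (hR.coprime_card_of_coprime hNc)).mono_right hle
    exact hbot ▸ Subgroup.IsSubnormal.bot
  obtain ⟨q, hq, S, hS, a, x, hx, hax⟩ :=
    hR.exists_sylow_forall_map_mem_and_exists_ne φ hNc hφ
  let U := (S : Subgroup N).map N.subtype
  have hUc : Nat.card U = Nat.card S := Subgroup.card_map_of_injective N.subtype_injective
  have hSc : p.Coprime (Nat.card S) := hNc.coprime_dvd_right (Subgroup.card_subgroup_dvd_card _)
  have hU : ∀ r ∈ R, ∀ u ∈ U, r * u * r⁻¹ ∈ U := by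
    rintro r hr _ ⟨y, hy, rfl⟩
    exact ⟨_, hS ⟨r, hr⟩ y hy, rfl⟩
  have hne : (a : G) * (x : G) * (a : G)⁻¹ ≠ x := fun h ↦ hax (Subtype.ext h)
  have hsup : U ⊔ R = ⊤ := by
    by_contra hcon
    refine hne (mul_inv_eq_iff_eq_mul.2 ?_)
    exact hws.commute_of_sup_ne_top hR (hUc ▸ hSc) hU hcon a a.2 x ⟨x, hx, rfl⟩
  refine ⟨q, U, Subgroup.normal_of_sup_eq_top hU hsup, hq, ?_, S.2.map _, hUc ▸ hSc, hsup,
    a, a.2, x, ⟨x, hx, rfl⟩, hne⟩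
  rintro rfl
  have := Subgroup.disjoint_of_coprime_natCard (S.2.coprime_card_of_coprime hSc)
  have hx1 : x = 1 := Subgroup.mem_bot.1 (disjoint_self.1 this ▸ hx)
  exact hax (by simp [hx1])

lemma IsWeaklySubnormal.isMinimallyNontrivial (hR : IsPGroup p R) (hws : IsWeaklySubnormal R)
    {Q : Subgroup G} [Q.Normal] (hQ : p.Coprime (Nat.card Q))
    (hne : ∃ r ∈ R, ∃ x ∈ Q, r * x * r⁻¹ ≠ x) :
    IsMinimallyNontrivial ((MulAut.conjNormal.comp R.subtype : R →* MulAut Q)) where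
  nontrivial := by
    obtain ⟨r, hr, x, hx, h⟩ := hne
    exact ⟨⟨r, hr⟩, ⟨x, hx⟩, fun h1 ↦ h (congrArg Subtype.val h1)⟩
  fixed V hV hVne := by
    have hnorm : ∀ r ∈ R, ∀ u ∈ V.map Q.subtype, r * u * r⁻¹ ∈ V.map Q.subtype := by
      rintro r hr _ ⟨y, hy, rfl⟩
      exact ⟨_, hV ⟨r, hr⟩ y hy, rfl⟩
    have hc : p.Coprime (Nat.card (V.map Q.subtype)) := by
      rw [Subgroup.card_map_of_injective Q.subtype_injective]
      exact hQ.coprime_dvd_right (Subgroup.card_subgroup_dvd_card _)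
    -- If `VR = G`, then `V = Q` by Dedekind's law, because `Q ∩ R = 1`.
    have hsup : V.map Q.subtype ⊔ R ≠ ⊤ := by
      intro hsup
      refine hVne (top_le_iff.1 fun x _ ↦ ?_)
      have := Subgroup.normal_of_sup_eq_top hnorm hsup
      have hx : (x : G) ∈ V.map Q.subtype ⊔ R := hsup ▸ Subgroup.mem_top _
      obtain ⟨_, ⟨v, hv, rfl⟩, r, hr, hvr⟩ := Subgroup.mem_sup_of_normal_left.1 hx
      have hrQ : r ∈ Q := by
        rw [eq_inv_mul_iff_mul_eq.2 hvr]
        exact mul_mem (inv_mem v.2) x.2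
      have hr1 : r = 1 := Subgroup.disjoint_def.1
        (Subgroup.disjoint_of_coprime_natCard (hR.coprime_card_of_coprime hQ)) hr hrQ
      rw [hr1, mul_one] at hvr
      exact Q.subtype_injective hvr ▸ hv
    intro a u hu
    refine Subtype.ext (mul_inv_eq_iff_eq_mul.2 ?_)
    exact hws.commute_of_sup_ne_top hR hc hnorm hsup a a.2 u ⟨u, hu, rfl⟩

lemma IsMinimallyNontrivial.actsIrreduciblyOnFrattiniQuotient {Q : Subgroup G} [Q.Normal]
    [Group.IsNilpotent Q] (hc : (Nat.card R).Coprime (Nat.card Q))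
    (h : IsMinimallyNontrivial ((MulAut.conjNormal.comp R.subtype : R →* MulAut Q))) :
    ActsIrreduciblyOnFrattiniQuotient R Q := by
  refine ⟨QuotientGroup.nontrivial_iff.2 (h.commutator_eq_frattini hc).2, fun V hV ↦ ?_⟩
  have hsurj := QuotientGroup.mk'_surjective (frattini Q)
  rw [or_iff_not_imp_right]
  intro hne
  have hle := h.le_frattini hc (U := V.comap (QuotientGroup.mk' (frattini Q)))
    (fun r u hu ↦ hV r r.2 _ hu) fun htop ↦ hne <| by
      rw [← Subgroup.map_comap_eq_self_of_surjective hsurj V, htop,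
        Subgroup.map_top_of_surjective _ hsurj]
  rw [← Subgroup.map_comap_eq_self_of_surjective hsurj V, Subgroup.map_eq_bot_iff,
    QuotientGroup.ker_mk']
  exact hle

end

theorem theorem1p1 (p : ℕ) (hp : p.Prime) (G : Type*) [Group G] [Finite G]
    (hG : IsPSolvable p G) (hcore : pCore p G = ⊥)
    (R : Subgroup G) (hR : IsPGroup p R) (hws : IsWeaklySubnormal R) :
    (∃ (q : ℕ) (Q : Subgroup G) (_ : Q.Normal),
      q.Prime ∧ q ≠ p ∧
      IsSpecialGroup q Q ∧
      (Q : Set G) * (R : Set G) = Set.univ ∧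
      (∀ r ∈ R, ∀ x ∈ frattini Q, r * (x : G) * r⁻¹ = (x : G)) ∧
      ActsIrreduciblyOnFrattiniQuotient R Q) ∧
    Group.IsSolvable G ∧
    ∃ P : Sylow p G, (P : Subgroup G) = R := by
  have := Fact.mk hp
  obtain ⟨q, Q, hQn, hq, hqp, hQ, hQc, hsup, hne⟩ := hws.exists_normal_supplement hG hcore hR
  have := Fact.mk hq
  have := hQ.isNilpotent
  have := hR.isNilpotent
  have hc := hR.coprime_card_of_coprime hQc
  have hmin := hws.isMinimallyNontrivial hR hQc hne
  refine ⟨⟨q, Q, hQn, hq, hqp, hmin.isSpecialGroup hc hQ, ?_, fun r hr x hx ↦ ?_,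
    hmin.actsIrreduciblyOnFrattiniQuotient hc⟩, isSolvable_of_sup_eq_top hsup,
    hR.toSylow (not_dvd_index_of_sup_eq_top hQc hsup), rfl⟩
  · rw [← Subgroup.normal_mul, hsup, Subgroup.coe_top]
  · exact congrArg Subtype.val (hmin.fixed_of_mem_frattini hc ⟨r, hr⟩ hx)
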